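/- Let $N\ge 1$ be an integer. For $0\le k\le M$ let $s_k^{(M)}$ denote the $k$-th elementary symmetric polynomial in $M$ variables, with $s_0^{(M)}=1$. In $\mathbb C[c_1,\dots,c_N]$ put $$\alpha_j = s_j^{(N)}(c_1,\dots,c_N)-(-1)^j c_j \quad (1\le j\le N-1),\qquad \widetilde\alpha_N = s_{N-1}^{(N-1)}(c_1,\dots,c_{N-1})-(-1)^N ,$$ and let $\widetilde I_N$ be the ideal of $\mathbb C[c_1,\dots,c_N]$ generated by $\alpha_1,\dots,\alpha_{N-1},\widetilde\alpha_N$. The homogenization of a nonzero polynomial $p\in\mathbb C[c_1,\dots,c_N]$ of degree $d$ is $\widehat p(C_0,\dots,C_N)=C_0^{d}\,p(C_1/C_0,\dots,C_N/C_0)$. Let $\widetilde I_N^*$ be the ideal of $\mathbb C[C_0,C_1,\dots,C_N]$ generated by the homogenizations of $\alpha_1,\dots,\alpha_{N-1},\widetilde\alpha_N$. If $\widetilde I_N^*$ is a radical ideal, that is, $\sqrt{\widetilde I_N^*}=\widetilde I_N^*$, then $$|V(\widetilde I_N)|=(N-1)\cdot (N-1)!,$$ where $V(\widetilde I_N)\subseteq\mathbb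 C^N$ is the set of common zeros of $\widetilde I_N$; that is, the system $\alpha_1=\dots=\alpha_{N-1}=\widetilde\alpha_N=0$ has exactly $(N-1)\cdot(N-1)!$ distinct solutions in $\mathbb C^N$. -/

import Mathlib

open scoped Nat

noncomputable section

namespace Ulam

open MvPolynomial

/-- The homogenization `C₀ ^ d * p (C₁ / C₀, …, C_N / C₀)` of a polynomial `p` of total degree `d`
in the `N` variables `c₁, …, c_N`. The variable `c_i` is `X i` with `i : Fin N` counted from `0`;
among the homogeneous variables indexed by `Fin (N + 1)`, `X 0` is `C₀` and `X i.succ` is the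
variable corresponding to `X i`. Each monomial `m` of `p` is multiplied by `C₀ ^ (d - deg m)`. -/
def homogenization {N : ℕ} (p : MvPolynomial (Fin N) ℂ) : MvPolynomial (Fin (N + 1)) ℂ :=
  ∑ m ∈ p.support, monomial (Finsupp.cons (p.totalDegree - m.degree) m) (p.coeff m)

/-- `α_{j+1} = s_{j+1}(c₁, …, c_N) - (-1) ^ (j+1) * c_{j+1}`, with `j : Fin N` counted from `0` and
`s_k` the elementary symmetric polynomial of degree `k` in `N` variables. -/
def alpha (N : ℕ) (j : Fin N) : MvPolynomial (Fin N) ℂ :=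
  esymm (Fin N) ℂ (j + 1) - C ((-1) ^ (j.val + 1)) * X j

/-- The polynomial `s_{N-1}(c₁, …, c_{N-1}) - (-1) ^ N`, regarded as a polynomial in
`c₁, …, c_N` (for `N ≥ 1`); here `s_{N-1}` is the elementary symmetric polynomial of degree `N - 1`
in the first `N - 1` variables (the constant `1` if `N = 1`). -/
def alphaTilde (N : ℕ) : MvPolynomial (Fin N) ℂ :=
  rename (Fin.castLE (Nat.sub_le N 1)) (esymm (Fin (N - 1)) ℂ (N - 1)) - C ((-1) ^ N)

/-- The system `α₁, …, α_{N-1}, α̃_N`. -/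
def system (N : ℕ) (j : Fin N) : MvPolynomial (Fin N) ℂ :=
  if j.val + 1 < N then alpha N j else alphaTilde N

/-- The ideal `Ĩ_N` of `ℂ[c₁, …, c_N]` generated by `α₁, …, α_{N-1}, α̃_N`. -/
def idealTilde (N : ℕ) : Ideal (MvPolynomial (Fin N) ℂ) :=
  Ideal.span (Set.range (system N))

/-- The ideal `Ĩ*_N` of `ℂ[C₀, …, C_N]` generated by the homogenizations of
`α₁, …, α_{N-1}, α̃_N`. -/
def idealTildeStar (N : ℕ) : Ideal (MvPolynomial (Fin (N + 1)) ℂ) :=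
  Ideal.span (Set.range fun j => homogenization (system N j))

end Ulam

end

/-! The zeros of a radical ideal with finite-dimensional quotient are counted by the dimension of
the quotient. Radicality passes from the homogenized system to the affine one by inverting `C₀`, so
it remains to find that dimension for `N = n + 2`. The degrees are `1, …, N - 1` and `N - 1`, with
product `(N - 1) * (N - 1)!`, the Bézout number.

To see that this number is attained, let `f i` be the equations, of degrees `d i`, with leading
forms `g i`, and suppose that forms `e a`, for `a < d`, of degree `∑ i, a i`, span the ring modulo
the `g i`. The linear map `X ^ m ↦ ∏ i, f i ^ (m i / d i) * e (m % d)` respects the degree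
filtration and is onto in each filtered piece, hence bijective. It carries the ideal of the `X i ^ d
i` to that of the `f i`, so the `e a` are a basis modulo the `f i`.

Here the leading forms are `s₁ + c₁, s₂, …, s_{N-1}` and `c₁ ⋯ c_{N-1}`. The last one is a product,
so it suffices to span modulo each single `c_i` and glue. Once `c_i = 0`, all elementary symmetric
functions of the remaining variables are known up to `c₁`, and staircase monomials span as in the
coinvariant algebra. -/

namespace Ulam

open MvPolynomial

/-! ### Bézout's count from a spanning set modulo leading forms -/

section Bezout

variable {k σ : Type*} [Field k] [Fintype σ]

/-- The `k`-linear map sending the monomial `X ^ m` to `∏ i, f i ^ (m i / d i) * e (m % d)`. -/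
noncomputable def divModMap (d : σ → ℕ) (f : σ → MvPolynomial σ k)
    (e : (σ → ℕ) → MvPolynomial σ k) : MvPolynomial σ k →ₗ[k] MvPolynomial σ k :=
  (basisMonomials σ k).constr k
    fun m => (∏ i, f i ^ (m i / d i)) * e fun i => m i % d i

lemma divModMap_monomial (d : σ → ℕ) (f : σ → MvPolynomial σ k)
    (e : (σ → ℕ) → MvPolynomial σ k) (m : σ →₀ ℕ) :
    divModMap d f e (monomial m 1) = (∏ i, f i ^ (m i / d i)) * e fun i => m i % d i := by
  have := (basisMonomials σ k).constr_basis k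
    (fun m => (∏ i, f i ^ (m i / d i)) * e fun i => m i % d i) m
  simpa [divModMap] using this

/-- Adding `d i` to the `i`-th exponent raises its quotient by one and keeps all remainders. This is
how the ideal of the `X i ^ d i` is matched with the ideal of the `f i`. -/
lemma divModMap_X_pow_mul {d : σ → ℕ} (hd : ∀ i, 0 < d i) (f : σ → MvPolynomial σ k)
    (e : (σ → ℕ) → MvPolynomial σ k) (i : σ) (p : MvPolynomial σ k) :
    divModMap d f e (X i ^ d i * p) = f i * divModMap d f e p := by
  classical
  suffices h : divModMap d f e ∘ₗ LinearMap.mulLeft k (X i ^ d i) =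
      LinearMap.mulLeft k (f i) ∘ₗ divModMap d f e from LinearMap.congr_fun h p
  refine (basisMonomials σ k).ext fun m => ?_
  simp only [coe_basisMonomials, LinearMap.comp_apply, LinearMap.mulLeft_apply]
  rw [X_pow_eq_monomial, monomial_mul, one_mul, divModMap_monomial, divModMap_monomial,
    ← mul_assoc]
  congr 1
  · rw [← Finset.mul_prod_erase _ _ (Finset.mem_univ i),
      ← Finset.mul_prod_erase (a := i) _ (fun i => f i ^ (m i / d i)) (Finset.mem_univ i),
      ← mul_assoc]
    congr 1
    · simp [Nat.add_div_left _ (hd i), pow_succ']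
    · refine Finset.prod_congr rfl fun j hj => ?_
      simp [(Finset.ne_of_mem_erase hj).symm]
  · congr 1
    ext j
    by_cases h : i = j
    · subst h; simp
    · simp [h]

lemma totalDegree_divModMap_le {d : σ → ℕ} {f : σ → MvPolynomial σ k}
    {e : (σ → ℕ) → MvPolynomial σ k} (hf : ∀ i, (f i).totalDegree ≤ d i)
    (he : ∀ a, (e a).totalDegree ≤ ∑ i, a i) (p : MvPolynomial σ k) :
    (divModMap d f e p).totalDegree ≤ p.totalDegree := by
  rw [← mem_restrictTotalDegree]
  suffices h : divModMap d f e (∑ m ∈ p.support, monomial m (coeff m p)) ∈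
      restrictTotalDegree σ k p.totalDegree by rwa [← p.as_sum] at h
  rw [map_sum]
  refine Submodule.sum_mem _ fun m hm => ?_
  rw [← mul_one (coeff m p), ← smul_eq_mul, ← smul_monomial, map_smul]
  refine Submodule.smul_mem _ _ ?_
  rw [mem_restrictTotalDegree, divModMap_monomial]
  refine le_trans ?_ (le_totalDegree hm)
  calc _ ≤ (∑ i, (m i / d i) * d i) + ∑ i, m i % d i := by
        refine (totalDegree_mul _ _).trans (add_le_add ?_ (he _))
        refine (totalDegree_finsetProd _ _).trans (Finset.sum_le_sum fun i _ => ?_)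
        exact (totalDegree_pow _ _).trans (Nat.mul_le_mul_left _ (hf i))
    _ = m.sum fun _ e => e := by
        rw [← Finset.sum_add_distrib, Finsupp.sum_fintype _ _ (by simp)]
        exact Finset.sum_congr rfl fun i _ => by rw [mul_comm]; exact Nat.div_add_mod _ _

omit [Fintype σ] in
lemma totalDegree_mul_le_of_le {p q : MvPolynomial σ k} {a b : ℕ} (hp : p.totalDegree ≤ a)
    (hq : q.totalDegree ≤ b) : (p * q).totalDegree ≤ a + b :=
  (totalDegree_mul p q).trans (add_le_add hp hq)

/-- If the `e a` with `a < d` span the polynomial ring modulo the leading forms `g i` of the `f i`,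
then `divModMap d f e` is surjective in each degree. -/
lemma exists_divModMap_eq {d : σ → ℕ} (hd : ∀ i, 0 < d i) {f g : σ → MvPolynomial σ k}
    {e : (σ → ℕ) → MvPolynomial σ k} (hg : ∀ i, (g i).IsHomogeneous (d i))
    (hfg : ∀ i, (f i - g i).totalDegree < d i) (he : ∀ a, (e a).IsHomogeneous (∑ i, a i))
    (hspan : Submodule.span k (e '' {a | ∀ i, a i < d i}) ⊔
      (Ideal.span (Set.range g)).restrictScalars k = ⊤)
    (M : ℕ) {p : MvPolynomial σ k} (hp : p.totalDegree ≤ M) :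
    ∃ q : MvPolynomial σ k, q.totalDegree ≤ M ∧ divModMap d f e q = p := by
  classical
  set S : ℕ → Submodule k (MvPolynomial σ k) := fun M =>
    (restrictTotalDegree σ k M).map (divModMap d f e) with hS
  have hmem : ∀ M p, p ∈ S M ↔ ∃ q : MvPolynomial σ k, q.totalDegree ≤ M ∧
      divModMap d f e q = p := by
    intro M p
    simp [hS, mem_restrictTotalDegree]
  have hmono : Monotone S := by
    intro a b hab p
    rw [hmem, hmem]
    rintro ⟨q, hq, rfl⟩
    exact ⟨q, hq.trans hab, rfl⟩
  rw [← hmem]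
  have key : ∀ M, ∀ q : MvPolynomial σ k, homogeneousComponent M q ∈ S M := by
    intro M
    induction M using Nat.strong_induction_on with
    | _ M ih =>
    have ih' : ∀ j < M, ∀ q : MvPolynomial σ k, q.totalDegree ≤ j → q ∈ S j := by
      intro j hj q hq
      rw [← sum_homogeneousComponent q]
      refine Submodule.sum_mem _ fun i hi => ?_
      have : i ≤ j := by have := Finset.mem_range.1 hi; omega
      exact hmono this (ih i (this.trans_lt hj) q)
    suffices h : (⊤ : Submodule k (MvPolynomial σ k)) ≤ (S M).comap (homogeneousComponent M) from
      fun q => h (Submodule.mem_top (x := q))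
    rw [← hspan, sup_le_iff]
    constructor
    · rw [Submodule.span_le]
      rintro _ ⟨a, ha, rfl⟩
      simp only [SetLike.mem_coe, Submodule.mem_comap]
      rw [homogeneousComponent_of_mem (he a)]
      split_ifs with h
      · rw [hmem]
        refine ⟨monomial (Finsupp.equivFunOnFinite.symm a) 1, ?_, ?_⟩
        · rw [totalDegree_monomial _ one_ne_zero, Finsupp.sum_fintype _ _ (by simp)]
          simp [h]
        · rw [divModMap_monomial]
          have h1 : ∀ i, a i / d i = 0 := fun i => Nat.div_eq_of_lt (ha i)
          have h2 : ∀ i, a i % d i = a i := fun i => Nat.mod_eq_of_lt (ha i)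
          simp [h1, h2]
      · exact Submodule.zero_mem _
    · intro p hp
      rw [Submodule.restrictScalars_mem, Ideal.mem_span_range_iff_exists_fun] at hp
      obtain ⟨h, rfl⟩ := hp
      refine Submodule.sum_mem _ fun i _ => ?_
      rw [← sum_homogeneousComponent (h i), Finset.sum_mul]
      refine Submodule.sum_mem _ fun j _ => ?_
      have hj := homogeneousComponent_isHomogeneous j (h i)
      set r := homogeneousComponent j (h i)
      rw [Submodule.mem_comap, homogeneousComponent_of_mem (hj.mul (hg i))]
      split_ifs with hM
      · have hr := hj.totalDegree_le
        -- Trade `g i` for `f i`: the cofactor `r` has degree below `M`, and the error `r * (f i - g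
        -- i)` does too, so induction covers both.
        have h1 : r * g i = f i * r - r * (f i - g i) := by ring
        have hdi := hd i
        rw [h1]
        refine Submodule.sub_mem _ ?_ ?_
        · obtain ⟨q, hq, hqr⟩ := (hmem _ _).1 (ih' j (by omega) r hr)
          rw [hmem]
          refine ⟨X i ^ d i * q, ?_, by rw [divModMap_X_pow_mul hd, hqr]⟩
          refine (totalDegree_mul_le_of_le ?_ hq).trans (by omega : d i + j ≤ M)
          simp
        · refine hmono (by omega : M - 1 ≤ M) (ih' (M - 1) (by omega) _ ?_)
          have := hfg i
          exact (totalDegree_mul_le_of_le hr (by omega : _ ≤ d i - 1)).trans (by omega)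
      · exact Submodule.zero_mem _
  rw [← sum_homogeneousComponent p]
  refine Submodule.sum_mem _ fun i hi => hmono ?_ (key i p)
  have := Finset.mem_range.1 hi
  omega

/-- Polynomials of degree at most `M` form a finite-dimensional space that the map preserves, so
surjectivity there forces injectivity. -/
lemma divModMap_bijective {d : σ → ℕ} (hd : ∀ i, 0 < d i) {f g : σ → MvPolynomial σ k}
    {e : (σ → ℕ) → MvPolynomial σ k} (hg : ∀ i, (g i).IsHomogeneous (d i))
    (hfg : ∀ i, (f i - g i).totalDegree < d i) (he : ∀ a, (e a).IsHomogeneous (∑ i, a i))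
    (hspan : Submodule.span k (e '' {a | ∀ i, a i < d i}) ⊔
      (Ideal.span (Set.range g)).restrictScalars k = ⊤) :
    Function.Bijective (divModMap d f e) := by
  refine ⟨?_, fun p => ?_⟩
  · rw [injective_iff_map_eq_zero]
    intro p hp
    have hf : ∀ i, (f i).totalDegree ≤ d i := fun i => by
      have h := totalDegree_add (f i - g i) (g i)
      rw [sub_add_cancel] at h
      exact h.trans (max_le (hfg i).le (hg i).totalDegree_le)
    have hle : ∀ q ∈ restrictTotalDegree σ k p.totalDegree,
        divModMap d f e q ∈ restrictTotalDegree σ k p.totalDegree := fun q hq => by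
      rw [mem_restrictTotalDegree] at hq ⊢
      exact (totalDegree_divModMap_le hf (fun a => (he a).totalDegree_le) q).trans hq
    have hsurj : Function.Surjective ((divModMap d f e).restrict hle) := by
      rintro ⟨q, hq⟩
      rw [mem_restrictTotalDegree] at hq
      obtain ⟨r, hr, hrq⟩ := exists_divModMap_eq hd hg hfg he hspan _ hq
      exact ⟨⟨r, (mem_restrictTotalDegree _ _ _).2 hr⟩, Subtype.ext hrq⟩
    have hinj := LinearMap.injective_iff_surjective.2 hsurj
    have h0 := @hinj ⟨p, (mem_restrictTotalDegree _ _ _).2 le_rfl⟩ 0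
      (Subtype.ext (by simpa using hp))
    simpa using congrArg Subtype.val h0
  · obtain ⟨q, -, hq⟩ := exists_divModMap_eq hd hg hfg he hspan _ (le_refl p.totalDegree)
    exact ⟨q, hq⟩

omit [Fintype σ] in
lemma exists_monomial_eq_X_pow_mul {d : σ → ℕ} {m : σ →₀ ℕ} {i : σ} (h : d i ≤ m i) :
    ∃ q : MvPolynomial σ k, monomial m 1 = X i ^ d i * q := by
  refine ⟨monomial (m - Finsupp.single i (d i)) 1, ?_⟩
  rw [X_pow_eq_monomial, monomial_mul, one_mul, add_tsub_cancel_of_le]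
  simpa using h

/-- A case of Bézout's theorem: if the products `e a` with `a < d` span the polynomial ring modulo
the leading forms of the `f i`, they form a basis modulo the `f i`. -/
theorem nonempty_basis_quotient {d : σ → ℕ} (hd : ∀ i, 0 < d i) {f g : σ → MvPolynomial σ k}
    {e : (σ → ℕ) → MvPolynomial σ k} (hg : ∀ i, (g i).IsHomogeneous (d i))
    (hfg : ∀ i, (f i - g i).totalDegree < d i) (he : ∀ a, (e a).IsHomogeneous (∑ i, a i))
    (hspan : Submodule.span k (e '' {a | ∀ i, a i < d i}) ⊔
      (Ideal.span (Set.range g)).restrictScalars k = ⊤) :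
    Nonempty (Module.Basis (∀ i, Fin (d i)) k (MvPolynomial σ k ⧸ Ideal.span (Set.range f))) := by
  classical
  obtain ⟨hinj, hsurj⟩ := divModMap_bijective hd hg hfg he hspan
  set T := divModMap d f e with hT
  set L : Set (σ →₀ ℕ) := {m | ∀ i, m i < d i} with hL
  let π : MvPolynomial σ k →ₗ[k] MvPolynomial σ k ⧸ Ideal.span (Set.range f) :=
    (Ideal.Quotient.mkₐ k (Ideal.span (Set.range f))).toLinearMap
  have hπ : ∀ p, π p = 0 ↔ p ∈ Ideal.span (Set.range f) := fun p =>
    Ideal.Quotient.eq_zero_iff_mem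
  let Φ := π ∘ₗ T ∘ₗ (restrictSupport k L).subtype
  have hΦ : Function.Bijective Φ := by
    constructor
    · rw [injective_iff_map_eq_zero]
      rintro ⟨p, hp⟩ h0
      replace h0 : T p ∈ Ideal.span (Set.range f) := (hπ _).1 h0
      rw [Ideal.mem_span_range_iff_exists_fun] at h0
      obtain ⟨h, hh⟩ := h0
      choose q hq using fun i => hsurj (h i)
      -- Pulled back along the bijection, membership in the ideal of the `f i` puts `p` in the
      -- monomial ideal of the `X i ^ d i`, which contains no nonzero polynomial supported on `L`.
      have hpq : p = ∑ i, X i ^ d i * q i := by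
        apply hinj
        rw [← hh, map_sum]
        exact Finset.sum_congr rfl fun i _ => by
          rw [hT, divModMap_X_pow_mul hd, ← hT, hq, mul_comm]
      ext m
      simp only [ZeroMemClass.coe_zero, coeff_zero]
      by_contra hm
      have hmL : m ∈ L := ((mem_restrictSupport_iff k).1 hp) (mem_support_iff.2 hm)
      apply hm
      rw [hpq, coeff_sum]
      refine Finset.sum_eq_zero fun i _ => ?_
      rw [X_pow_eq_monomial, coeff_monomial_mul']
      rw [if_neg]
      intro hle
      have := hle i
      have := hmL i
      simp at *
      omega
    · intro x
      obtain ⟨y, rfl⟩ := Ideal.Quotient.mk_surjective x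
      obtain ⟨p, rfl⟩ := hsurj y
      change π (T p) ∈ LinearMap.range Φ
      rw [p.as_sum, map_sum, map_sum]
      refine Submodule.sum_mem _ fun m _ => ?_
      rw [← mul_one (coeff m p), ← smul_eq_mul, ← smul_monomial, map_smul, map_smul]
      refine Submodule.smul_mem _ _ ?_
      by_cases hm : m ∈ L
      · exact ⟨⟨monomial m 1, by simp [monomial_mem_restrictSupport, hm]⟩, rfl⟩
      · simp only [hL, Set.mem_ofPred_eq, not_forall, not_lt] at hm
        obtain ⟨i, hi⟩ := hm
        obtain ⟨q, hq⟩ := exists_monomial_eq_X_pow_mul (k := k) hi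
        rw [hq, hT, divModMap_X_pow_mul hd, (hπ _).2]
        · exact Submodule.zero_mem _
        · exact Ideal.mul_mem_right _ _ (Ideal.subset_span ⟨i, rfl⟩)
  let E : L ≃ ∀ i, Fin (d i) :=
    { toFun := fun m i => ⟨m.1 i, m.2 i⟩
      invFun := fun a => ⟨Finsupp.equivFunOnFinite.symm fun i => a i, fun i => by simp⟩
      left_inv := fun m => by ext; simp
      right_inv := fun a => by ext; simp }
  exact ⟨((basisRestrictSupport k L).map (LinearEquiv.ofBijective Φ hΦ)).reindex E⟩

end Bezout

/-! ### Counting the zeros of a radical ideal -/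

open MvPolynomial

/-- The number of zeros of a radical ideal with finite-dimensional quotient is the dimension of the
quotient. -/
theorem encard_zeroLocus_eq_finrank {k σ : Type*} [Field k] [IsAlgClosed k] [Finite σ]
    {I : Ideal (MvPolynomial σ k)} (hI : I.IsRadical)
    [Module.Finite k (MvPolynomial σ k ⧸ I)] :
    (zeroLocus k I).encard = (Module.finrank k (MvPolynomial σ k ⧸ I) : ℕ∞) := by
  classical
  let ev : zeroLocus k I → (MvPolynomial σ k ⧸ I) →ₐ[k] k := fun v =>
    Ideal.Quotient.liftₐ I (aeval v.1) v.2
  have hev : ∀ v p, ev v (Ideal.Quotient.mk I p) = aeval v.1 p := fun v p => rfl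
  -- Evaluations at distinct zeros are distinct characters, hence independent by Dedekind; this
  -- gives finiteness and the upper bound.
  have hli : LinearIndependent k fun v => (ev v).toLinearMap := by
    have hinj : Function.Injective fun v =>
        ((ev v : (MvPolynomial σ k ⧸ I) →* k)) := by
      intro v w h
      refine Subtype.ext (funext fun i => ?_)
      have := DFunLike.congr_fun h (Ideal.Quotient.mk I (X i))
      simpa [hev] using this
    have h := (linearIndependent_monoidHom (MvPolynomial σ k ⧸ I) k).comp _ hinj
    let coe : Module.Dual k (MvPolynomial σ k ⧸ I) →ₗ[k] (MvPolynomial σ k ⧸ I) → k :=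
      { toFun := fun Φ => Φ
        map_add' := fun _ _ => rfl
        map_smul' := fun _ _ => rfl }
    exact LinearIndependent.of_comp coe h
  have := hli.finite
  cases nonempty_fintype (zeroLocus k I)
  have h1 : Fintype.card (zeroLocus k I) ≤ Module.finrank k (MvPolynomial σ k ⧸ I) := by
    rw [← Subspace.dual_finrank_eq]
    exact hli.fintype_card_le_finrank
  have h2 : Module.finrank k (MvPolynomial σ k ⧸ I) ≤ Fintype.card (zeroLocus k I) := by
    rw [← Module.finrank_fintype_fun_eq_card (R := k)]
    refine LinearMap.finrank_le_finrank_of_injective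
      (f := LinearMap.pi fun v => (ev v).toLinearMap) ?_
    rw [injective_iff_map_eq_zero]
    intro x hx
    obtain ⟨p, rfl⟩ := Ideal.Quotient.mk_surjective x
    -- By the Nullstellensatz, a class vanishing at every zero is zero; this gives the lower bound.
    rw [Ideal.Quotient.eq_zero_iff_mem, ← hI.radical,
      ← vanishingIdeal_zeroLocus_eq_radical (K := k), mem_vanishingIdeal_iff]
    exact fun v hv => congrFun hx ⟨v, hv⟩
  rw [Set.encard, ENat.card_eq_coe_fintype_card, le_antisymm h1 h2]

/-! ### Radicality under dehomogenization -/

lemma aeval_cons_one_homogenization {N : ℕ} (p : MvPolynomial (Fin N) ℂ) :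
    aeval (Fin.cons 1 X : Fin (N + 1) → MvPolynomial (Fin N) ℂ) (homogenization p) = p := by
  conv_rhs => rw [p.as_sum]
  rw [homogenization, map_sum]
  refine Finset.sum_congr rfl fun m _ => ?_
  rw [aeval_monomial, Finsupp.prod_fintype _ _ (by simp), Fin.prod_univ_succ, monomial_eq,
    Finsupp.prod_fintype _ _ (by simp)]
  simp [algebraMap_eq]

lemma aeval_div_X_zero_mul_pow {N : ℕ} (p : MvPolynomial (Fin N) ℂ)
    {L : Type*} [CommRing L] [Algebra (MvPolynomial (Fin (N + 1)) ℂ) L] [Algebra ℂ L]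
    [IsScalarTower ℂ (MvPolynomial (Fin (N + 1)) ℂ) L] {u : L}
    (hu : algebraMap (MvPolynomial (Fin (N + 1)) ℂ) L (X 0) * u = 1) :
    aeval (fun i : Fin N => algebraMap (MvPolynomial (Fin (N + 1)) ℂ) L (X i.succ) * u) p *
      algebraMap (MvPolynomial (Fin (N + 1)) ℂ) L (X 0) ^ p.totalDegree =
      algebraMap (MvPolynomial (Fin (N + 1)) ℂ) L (homogenization p) := by
  conv_lhs => enter [1]; rw [p.as_sum, map_sum]
  rw [homogenization, map_sum, Finset.sum_mul]
  refine Finset.sum_congr rfl fun m hm => ?_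
  have hle : m.degree ≤ p.totalDegree := le_totalDegree hm
  have hdeg : m.degree = ∑ i, m i := Finsupp.degree_eq_sum m
  rw [aeval_monomial, Finsupp.prod_fintype _ _ (by simp), monomial_eq,
    Finsupp.prod_fintype _ _ (by simp), Fin.prod_univ_succ]
  simp only [Finsupp.cons_zero, Finsupp.cons_succ, mul_pow, Finset.prod_mul_distrib,
    Finset.prod_pow_eq_pow_sum, map_mul, map_pow, map_prod]
  rw [← hdeg, ← algebraMap_eq, ← IsScalarTower.algebraMap_apply]
  have h1 : u ^ m.degree * algebraMap (MvPolynomial (Fin (N + 1)) ℂ) L (X 0) ^ m.degree = 1 := by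
    rw [← mul_pow, mul_comm, hu, one_pow]
  have h2 : algebraMap (MvPolynomial (Fin (N + 1)) ℂ) L (X 0) ^ p.totalDegree =
      algebraMap (MvPolynomial (Fin (N + 1)) ℂ) L (X 0) ^ (p.totalDegree - m.degree) *
        algebraMap (MvPolynomial (Fin (N + 1)) ℂ) L (X 0) ^ m.degree := by
    rw [← pow_add, Nat.sub_add_cancel hle]
  rw [h2]
  linear_combination (algebraMap ℂ L (coeff m p) *
    (∏ i : Fin N, algebraMap (MvPolynomial (Fin (N + 1)) ℂ) L (X i.succ) ^ m i) *
    algebraMap (MvPolynomial (Fin (N + 1)) ℂ) L (X 0) ^ (p.totalDegree - m.degree)) * h1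

/-- If the homogenizations of the `f i` generate a radical ideal, so do the `f i`. -/
theorem isRadical_span_of_homogenization {N : ℕ} {ι : Type*} (f : ι → MvPolynomial (Fin N) ℂ)
    (h : (Ideal.span (Set.range fun i => homogenization (f i))).IsRadical) :
    (Ideal.span (Set.range f)).IsRadical := by
  set J := Ideal.span (Set.range fun i => homogenization (f i))
  let S := MvPolynomial (Fin (N + 1)) ℂ
  let L := Localization.Away (X 0 : S)
  let u : L := IsLocalization.Away.invSelf (X 0 : S)
  have hu : algebraMap S L (X 0) * u = 1 := IsLocalization.Away.mul_invSelf (X 0 : S)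
  let ψ : MvPolynomial (Fin N) ℂ →ₐ[ℂ] L := aeval fun i => algebraMap S L (X i.succ) * u
  have hψ : ∀ p, ψ p * algebraMap S L (X 0) ^ p.totalDegree = algebraMap S L (homogenization p) :=
    fun p => aeval_div_X_zero_mul_pow p hu
  have hψI : Ideal.span (Set.range f) ≤ (J.map (algebraMap S L)).comap ψ := by
    rw [Ideal.span_le]
    rintro _ ⟨i, rfl⟩
    have h1 : ψ (f i) = algebraMap S L (homogenization (f i)) * u ^ (f i).totalDegree := by
      rw [← hψ, mul_assoc, ← mul_pow, hu, one_pow, mul_one]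
    rw [SetLike.mem_coe, Ideal.mem_comap, h1]
    exact Ideal.mul_mem_right _ _ (Ideal.mem_map_of_mem _ (Ideal.subset_span ⟨i, rfl⟩))
  have hδ : J ≤ (Ideal.span (Set.range f)).comap
      (aeval (Fin.cons 1 X : Fin (N + 1) → MvPolynomial (Fin N) ℂ)) := by
    rw [Ideal.span_le]
    rintro _ ⟨i, rfl⟩
    rw [SetLike.mem_coe, Ideal.mem_comap, aeval_cons_one_homogenization]
    exact Ideal.subset_span ⟨i, rfl⟩
  rintro p ⟨n, hn⟩
  have h1 : algebraMap S L (homogenization p ^ n) ∈ J.map (algebraMap S L) := by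
    rw [map_pow, ← hψ, mul_pow, ← map_pow]
    exact Ideal.mul_mem_right _ _ (hψI hn)
  rw [IsLocalization.algebraMap_mem_map_algebraMap_iff (Submonoid.powers (X 0 : S))] at h1
  obtain ⟨_, ⟨m, rfl⟩, hm⟩ := h1
  -- Localization only gives `X 0 ^ m * homogenization p ^ n ∈ J`. Radicality lowers both exponents
  -- to one, and the remaining `X 0` becomes `1` on dehomogenizing.
  have h2 : X 0 * homogenization p ∈ J := by
    refine h ⟨m + n, ?_⟩
    have : (X 0 * homogenization p) ^ (m + n) =
        (X 0 ^ m * homogenization p ^ n) * (X 0 ^ n * homogenization p ^ m) := by ring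
    rw [this]
    exact Ideal.mul_mem_right _ _ hm
  have h3 := hδ h2
  rwa [Ideal.mem_comap, map_mul, aeval_cons_one_homogenization, aeval_X, Fin.cons_zero,
    one_mul] at h3

end Ulam

namespace Ulam

/-! ### Gluing spanning sets and staircase monomials -/

section Span

/-- Spanning sets modulo `I + (y i)` for all `i < L` combine to a spanning set modulo
`I + (∏ i < L, y i)`. -/
lemma exists_sub_mem_sup_span_prod {k R : Type*} [CommRing k] [CommRing R] [Algebra k R]
    (I : Ideal R) (y : ℕ → R) (E : ℕ → Set R) (L : ℕ)
    (h : ∀ i < L, ∀ p, ∃ u ∈ Submodule.span k (E i), p - u ∈ I ⊔ Ideal.span {y i}) (p : R) :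
    ∃ u ∈ Submodule.span k {z | ∃ i < L, ∃ w ∈ E i, z = (∏ j ∈ Finset.range i, y j) * w},
      p - u ∈ I ⊔ Ideal.span {∏ j ∈ Finset.range L, y j} := by
  induction L with
  | zero => exact ⟨0, Submodule.zero_mem _, by simp⟩
  | succ L ih =>
    obtain ⟨u, hu, hpu⟩ := ih fun i hi => h i (by omega)
    rw [Submodule.mem_sup] at hpu
    obtain ⟨a, ha, b, hb, hab⟩ := hpu
    obtain ⟨c, rfl⟩ := Ideal.mem_span_singleton'.1 hb
    obtain ⟨v, hv, hcv⟩ := h L (by omega) c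
    rw [Submodule.mem_sup] at hcv
    obtain ⟨a', ha', b', hb', hab'⟩ := hcv
    obtain ⟨c', rfl⟩ := Ideal.mem_span_singleton'.1 hb'
    -- The remainder is `c * ∏ j < L, y j` modulo `I`; only `c` modulo `I + (y L)` matters, so `v`
    -- replaces it.
    refine ⟨u + (∏ j ∈ Finset.range L, y j) * v, Submodule.add_mem _ ?_ ?_, ?_⟩
    · refine Submodule.span_mono ?_ hu
      rintro z ⟨i, hi, w, hw, rfl⟩
      exact ⟨i, by omega, w, hw, rfl⟩
    · rw [← LinearMap.mulLeft_apply (R := k)]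
      refine Submodule.map_span_le (LinearMap.mulLeft k (∏ j ∈ Finset.range L, y j)) (E L) _ |>.2 ?_
        (Submodule.mem_map_of_mem hv)
      intro w hw
      exact Submodule.subset_span ⟨L, by omega, w, hw, rfl⟩
    · rw [Submodule.mem_sup]
      refine ⟨a + a' * ∏ j ∈ Finset.range L, y j,
        I.add_mem ha (I.mul_mem_right _ ha'), c' * ∏ j ∈ Finset.range (L + 1), y j,
        Ideal.mem_span_singleton'.2 ⟨c', rfl⟩, ?_⟩
      rw [Finset.prod_range_succ]
      linear_combination hab + (∏ j ∈ Finset.range L, y j) * hab'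

/-- The monomials `∏ j, x j ^ a j` with `a j < n - j`. -/
def staircase {B : Type*} [CommRing B] {n : ℕ} (x : Fin n → B) : Set B :=
  {z | ∃ a : Fin n → ℕ, (∀ j, a j < n - j) ∧ z = ∏ j, x j ^ a j}

open Polynomial in
lemma exists_map_eq_prod_tail {A B : Type*} [CommRing A] [CommRing B] [Algebra A B] {n : ℕ}
    (x : Fin (n + 1) → B) (x₀ : A) (hx₀ : algebraMap A B x₀ = x 0) (P : A[X])
    (hP : P.map (algebraMap A B) = ∏ j, (X - C (x j))) :
    ∃ Q : A[X], Q.map (algebraMap A B) = ∏ j : Fin n, (X - C (x j.succ)) := by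
  refine ⟨P /ₘ (X - C x₀), ?_⟩
  rw [map_divByMonic _ (monic_X_sub_C _), hP, Fin.prod_univ_succ]
  rw [Polynomial.map_sub, map_X, map_C, hx₀, mul_divByMonic_cancel_left _ (monic_X_sub_C _)]

/-- Tower argument: expand in the later variables over `A'`, then expand each coefficient in powers
of `x 0`. -/
lemma adjoin_le_span_staircase_succ {A B : Type*} [CommRing A] [CommRing B] [Algebra A B] {n : ℕ}
    (x : Fin (n + 1) → B) (A' : Subalgebra A B) (hx : x 0 ∈ A')
    (h₀ : Subalgebra.toSubmodule A' ≤ Submodule.span A {z | ∃ i < n + 1, z = x 0 ^ i})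
    (h : Subalgebra.toSubmodule (Algebra.adjoin A' (Set.range fun j : Fin n => x j.succ)) ≤
      Submodule.span A' (staircase fun j : Fin n => x j.succ)) :
    Subalgebra.toSubmodule (Algebra.adjoin A (Set.range x)) ≤
      Submodule.span A (staircase x) := by
  intro z hz
  have hz' : z ∈ Algebra.adjoin A' (Set.range fun j : Fin n => x j.succ) := by
    have hle : Algebra.adjoin A (Set.range x) ≤
        (Algebra.adjoin A' (Set.range fun j : Fin n => x j.succ)).restrictScalars A := by
      rw [Algebra.adjoin_le_iff]
      rintro _ ⟨j, rfl⟩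
      rw [SetLike.mem_coe, Subalgebra.mem_restrictScalars]
      cases j using Fin.cases with
      | zero =>
        exact Subalgebra.algebraMap_mem (Algebra.adjoin A' (Set.range fun j : Fin n => x j.succ))
          (⟨x 0, hx⟩ : A')
      | succ j => exact Algebra.subset_adjoin ⟨j, rfl⟩
    exact hle hz
  have hz'' := h hz'
  rw [Finsupp.mem_span_iff_linearCombination] at hz''
  obtain ⟨c, rfl⟩ := hz''
  rw [Finsupp.linearCombination_apply]
  refine Submodule.sum_mem _ fun s _ => ?_
  have hc := h₀ (c s).2
  obtain ⟨a, ha, hs⟩ := s.2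
  change c s • s.1 ∈ _
  rw [Subalgebra.smul_def, hs, smul_eq_mul, mul_comm,
    ← LinearMap.mulLeft_apply (R := A)]
  refine Submodule.map_span_le (LinearMap.mulLeft A _) _ _ |>.2 ?_ (Submodule.mem_map_of_mem hc)
  rintro _ ⟨i, hi, rfl⟩
  refine Submodule.subset_span ⟨Fin.cons i a, ?_, ?_⟩
  · refine Fin.cases (by simpa using hi) fun j => ?_
    have := ha j
    simp only [Fin.cons_succ, Fin.val_succ]
    omega
  · rw [Fin.prod_univ_succ, LinearMap.mulLeft_apply]
    simp [mul_comm]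

open Polynomial in
/-- If `∏ j, (X - x j)` has coefficients in `A`, the staircase monomials in the `x j` span
`A[x j]` as an `A`-module. -/
lemma adjoin_le_span_staircase {n : ℕ} : ∀ {A B : Type} [CommRing A] [CommRing B] [Algebra A B]
    (x : Fin n → B) (P : A[X]), P.map (algebraMap A B) = ∏ j, (X - C (x j)) →
    Subalgebra.toSubmodule (Algebra.adjoin A (Set.range x)) ≤
      Submodule.span A (staircase x) := by
  induction n with
  | zero =>
    intro A B _ _ _ x P hP z hz
    rw [Set.range_eq_empty, Algebra.adjoin_empty, Subalgebra.mem_toSubmodule, Algebra.mem_bot] at hz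
    obtain ⟨a, rfl⟩ := hz
    rw [Algebra.algebraMap_eq_smul_one]
    exact Submodule.smul_mem _ _ (Submodule.subset_span ⟨fun _ => 0, by simp, by simp⟩)
  | succ n ih =>
    intro A B _ _ _ x P hP
    rcases subsingleton_or_nontrivial B with hB | hB
    · exact fun z _ => by rw [Subsingleton.elim z 0]; exact Submodule.zero_mem _
    refine adjoin_le_span_staircase_succ x (Algebra.adjoin A {x 0})
      (Algebra.subset_adjoin (Set.mem_singleton _)) ?_ ?_
    · have hmonic : (∏ j, (X - C (x j))).Monic :=
        monic_prod_of_monic _ _ fun j _ => monic_X_sub_C _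
      -- `P` need not be monic, since `algebraMap A B` may kill leading coefficients; a monic lift
      -- of the right degree is needed to bound the powers of `x 0`.
      obtain ⟨P', hP', hdeg, hmon⟩ := lifts_and_natDegree_eq_and_monic
        ((mem_lifts _).2 ⟨P, hP⟩) hmonic
      rw [natDegree_prod_of_monic _ _ fun j _ => monic_X_sub_C _] at hdeg
      simp only [natDegree_X_sub_C, Finset.sum_const, Finset.card_univ, Fintype.card_fin,
        smul_eq_mul, mul_one] at hdeg
      have hroot : aeval (x 0) P' = 0 := by
        rw [← eval_map_algebraMap, hP', eval_prod]
        exact Finset.prod_eq_zero (Finset.mem_univ 0) (by simp)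
      rw [← Submodule.span_range_natDegree_eq_adjoin hmon hroot, hdeg]
      refine Submodule.span_mono ?_
      intro z hz
      simp only [Finset.coe_image, Finset.coe_range, Set.mem_image, Set.mem_Iio] at hz
      obtain ⟨i, hi, rfl⟩ := hz
      exact ⟨i, hi, rfl⟩
    · obtain ⟨Q, hQ⟩ := exists_map_eq_prod_tail (A := Algebra.adjoin A {x 0}) x
        ⟨x 0, Algebra.subset_adjoin (Set.mem_singleton _)⟩ rfl
        (P.map (algebraMap A (Algebra.adjoin A {x 0})))
        (by rw [Polynomial.map_map, ← IsScalarTower.algebraMap_eq, hP])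
      exact ih _ Q hQ

end Span

/-! ### The leading forms of the system -/

section Leading

open MvPolynomial

/-- The form of degree `j + 1` in `α_{j+1}`. -/
noncomputable def leadingForm (n : ℕ) (j : Fin (n + 1)) : MvPolynomial (Fin (n + 2)) ℂ :=
  esymm (Fin (n + 2)) ℂ (j + 1) + if j = 0 then X 0 else 0

/-- The forms of top degree of the system, in reverse order. -/
noncomputable def leadingForms (n : ℕ) : Fin (n + 2) → MvPolynomial (Fin (n + 2)) ℂ :=
  Fin.cons (∏ i : Fin (n + 1), X i.castSucc) fun j => leadingForm n j.rev

/-- The degrees of `leadingForms n`. -/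
def leadingDegrees (n : ℕ) : Fin (n + 2) → ℕ := Fin.cons (n + 1) fun j : Fin (n + 1) => n + 1 - j

/-- Polynomials that span the polynomial ring modulo `leadingForms n`. -/
noncomputable def leadingBasis (n : ℕ) (a : Fin (n + 2) → ℕ) : MvPolynomial (Fin (n + 2)) ℂ :=
  (∏ j ∈ Finset.range (a 0), X (Fin.ofNat (n + 2) j)) *
    ∏ j : Fin (n + 1), X ((Fin.ofNat (n + 2) (a 0)).succAbove j) ^ a j.succ

lemma isHomogeneous_esymm (n m : ℕ) : (esymm (Fin n) ℂ m).IsHomogeneous m := by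
  rw [esymm]
  refine IsHomogeneous.sum _ _ _ fun t ht => ?_
  have := IsHomogeneous.prod t (fun i => (X i : MvPolynomial (Fin n) ℂ)) (fun _ => 1)
    fun i _ => isHomogeneous_X ℂ i
  simpa [(Finset.mem_powersetCard.1 ht).2] using this

lemma isHomogeneous_leadingForm (n : ℕ) (j : Fin (n + 1)) :
    (leadingForm n j).IsHomogeneous (j + 1) := by
  refine (isHomogeneous_esymm _ _).add ?_
  split_ifs with h
  · subst h; exact isHomogeneous_X ℂ 0
  · exact isHomogeneous_zero _ _ _

lemma isHomogeneous_leadingForms (n : ℕ) (i : Fin (n + 2)) :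
    (leadingForms n i).IsHomogeneous (leadingDegrees n i) := by
  cases i using Fin.cases with
  | zero =>
    have := IsHomogeneous.prod Finset.univ
      (fun i : Fin (n + 1) => (X i.castSucc : MvPolynomial (Fin (n + 2)) ℂ)) (fun _ => 1)
      fun i _ => isHomogeneous_X ℂ _
    simpa [leadingForms, leadingDegrees] using this
  | succ j =>
    have h := isHomogeneous_leadingForm n j.rev
    have : (j.rev : ℕ) + 1 = n + 1 - j := by rw [Fin.val_rev]; omega
    rw [this] at h
    simpa [leadingForms, leadingDegrees] using h

lemma isHomogeneous_leadingBasis (n : ℕ) (a : Fin (n + 2) → ℕ) :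
    (leadingBasis n a).IsHomogeneous (∑ i, a i) := by
  rw [Fin.sum_univ_succ]
  refine IsHomogeneous.mul ?_ (IsHomogeneous.prod _ _ _ fun j _ => isHomogeneous_X_pow _ _)
  have := IsHomogeneous.prod (Finset.range (a 0))
    (fun j => (X (Fin.ofNat (n + 2) j) : MvPolynomial (Fin (n + 2)) ℂ)) (fun _ => 1)
    fun i _ => isHomogeneous_X ℂ _
  simpa using this

lemma totalDegree_system_rev_sub_lt (n : ℕ) (i : Fin (n + 2)) :
    (system (n + 2) i.rev - leadingForms n i).totalDegree < leadingDegrees n i := by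
  cases i using Fin.cases with
  | zero =>
    have h : system (n + 2) (Fin.rev 0) - leadingForms n 0 = - C ((-1) ^ (n + 2)) := by
      rw [system, if_neg (by simp), alphaTilde]
      simp only [leadingForms, Fin.cons_zero]
      have h1 : esymm (Fin (n + 2 - 1)) ℂ (n + 2 - 1) = ∏ i, X i := by
        rw [esymm]
        conv_lhs =>
          enter [1, 1]
          rw [show n + 2 - 1 = (Finset.univ : Finset (Fin (n + 2 - 1))).card by simp]
        rw [Finset.powersetCard_self, Finset.sum_singleton]
      rw [h1, map_prod]
      simp only [rename_X]
      rw [show (∏ i : Fin (n + 2 - 1), (X (Fin.castLE (Nat.sub_le (n + 2) 1) i) :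
        MvPolynomial (Fin (n + 2)) ℂ)) = ∏ i : Fin (n + 1), X i.castSucc from rfl]
      ring
    rw [h, ← C_neg, totalDegree_C]
    simp [leadingDegrees]
  | succ j =>
    have hv : (Fin.rev j.succ : Fin (n + 2)).val = j.rev.val := by
      rw [Fin.rev_succ, Fin.val_castSucc]
    have hj : j.rev.val + 1 = n + 1 - j := by rw [Fin.val_rev]; omega
    have h : system (n + 2) j.succ.rev - leadingForms n j.succ =
        - (C ((-1) ^ (j.rev.val + 1)) * X j.succ.rev) - if j.rev = 0 then X 0 else 0 := by
      rw [system, if_pos (by have := j.rev.isLt; omega), alpha, hv]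
      simp only [leadingForms, Fin.cons_succ, leadingForm]
      ring
    have hd : leadingDegrees n j.succ = j.rev.val + 1 := by
      rw [hj]; rfl
    rw [h, hd]
    -- In `α₁` the linear term is itself of top degree and belongs to the leading form, so the
    -- difference is zero; in the other `α_j` it has lower degree.
    by_cases h0 : j.rev = 0
    · rw [Fin.rev_succ, if_pos h0, h0]
      simp
    · rw [if_neg h0, sub_zero, totalDegree_neg]
      have h1 : 0 < j.rev.val := Nat.pos_of_ne_zero fun h => h0 (Fin.ext h)
      refine ((totalDegree_mul _ _).trans ?_).trans_lt (by omega : 1 < j.rev.val + 1)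
      rw [totalDegree_C, totalDegree_X]

end Leading

/-! ### Spanning modulo the leading forms -/

section LeadingSpan

-- By Vieta: `s₁ = -x 0`, the middle symmetric functions vanish by hypothesis, and the top one
-- vanishes because `x i = 0`. Cancelling the factor `X` coming from `x i` leaves the claim.
open Polynomial in
lemma prod_X_sub_C_succAbove {n : ℕ} {B : Type*} [CommRing B] [Algebra ℂ B] (x : Fin (n + 2) → B)
    (hx : ∀ j, MvPolynomial.aeval x (leadingForm n j) = 0) {i : Fin (n + 2)} (hi : x i = 0) :
    ∏ j, (X - C (x (i.succAbove j))) = X ^ (n + 1) + C (x 0) * X ^ n := by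
  set s : Multiset B := Finset.univ.val.map x with hs
  have hcard : Multiset.card s = n + 2 := by simp [hs]
  have hesymm : ∀ k, s.esymm k = MvPolynomial.aeval x (MvPolynomial.esymm (Fin (n + 2)) ℂ k) :=
    fun k => (MvPolynomial.aeval_esymm_eq_multiset_esymm _ _ _ _).symm
  have h0 : s.esymm 0 = 1 := by rw [hesymm, MvPolynomial.esymm_zero, map_one]
  have h1 : s.esymm 1 = - x 0 := by
    have := hx 0
    simp only [leadingForm, Fin.val_zero, zero_add, if_true, map_add, MvPolynomial.aeval_X] at this
    rw [hesymm]
    exact eq_neg_of_add_eq_zero_left this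
  have h2 : ∀ k ∈ Finset.range (n + 1), s.esymm (k + 1 + 1) = 0 := by
    intro k hk
    rw [Finset.mem_range] at hk
    by_cases hkn : k = n
    · have : s.esymm (Multiset.card s) = 0 := by
        rw [Multiset.esymm, Multiset.powersetCard_self]
        simp only [Multiset.map_singleton, Multiset.sum_singleton]
        exact Finset.prod_eq_zero (Finset.mem_univ i) hi
      rw [hcard] at this
      rw [hkn]
      exact this
    · have := hx ⟨k + 1, by omega⟩
      rw [leadingForm, if_neg (by simp [Fin.ext_iff]), add_zero] at this
      rw [hesymm]
      exact this
  have hprod : ∏ j, (X - C (x j)) = X * (X ^ (n + 1) + C (x 0) * X ^ n) := by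
    have h := Multiset.prod_X_sub_X_eq_sum_esymm s
    rw [hcard, Finset.sum_range_succ', Finset.sum_range_succ', Finset.sum_eq_zero] at h
    · rw [hs, Multiset.map_map] at h
      refine h.trans ?_
      rw [← hs, zero_add, h0, h1]
      simp
      ring
    · intro k hk
      rw [h2 k hk]
      simp
  rw [Fin.prod_univ_succAbove _ i, hi, C_0, sub_zero] at hprod
  exact monic_X.isRegular.left hprod

open Polynomial in
lemma adjoin_succAbove_le_span_staircase {n : ℕ} {B : Type} [CommRing B] [Algebra ℂ B]
    (x : Fin (n + 2) → B) (hx : ∀ j, MvPolynomial.aeval x (leadingForm n j) = 0)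
    {i : Fin (n + 2)} (hi : x i = 0) :
    Subalgebra.toSubmodule (Algebra.adjoin ℂ (Set.range fun j => x (i.succAbove j))) ≤
      Submodule.span ℂ (staircase fun j => x (i.succAbove j)) := by
  have hprod := prod_X_sub_C_succAbove x hx hi
  set y : Fin (n + 1) → B := fun j => x (i.succAbove j) with hy
  have h0 : x 0 = y 0 ∨ x 0 = 0 := by
    by_cases h : i = 0
    · right; rw [← h, hi]
    · left; rw [hy]; simp only [Fin.succAbove_ne_zero_zero h]
  -- The coefficient `x 0` is not a scalar, so the staircase lemma does not apply over `ℂ`.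
  -- Evaluating at `y 0` yields `y 0 ^ (n + 1) = 0`: if `x 0 = y 0` the relation is `2 * y 0 ^ (n +
  -- 1) = 0`, otherwise `x 0 = 0`. Over `ℂ[y 0]`, which contains `x 0`, the lemma then handles the
  -- other variables.
  have hroot : y 0 ^ (n + 1) + x 0 * y 0 ^ n = 0 := by
    have := congrArg (Polynomial.eval (y 0)) hprod
    rw [eval_prod, Finset.prod_eq_zero (Finset.mem_univ 0) (by simp [hy])] at this
    simpa using this.symm
  have hnil : y 0 ^ (n + 1) = 0 := by
    rcases h0 with h0 | h0
    · rw [h0, ← pow_succ', ← two_mul] at hroot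
      have h2 : IsUnit (2 : B) := by
        have := (IsUnit.mk0 (2 : ℂ) two_ne_zero).map (algebraMap ℂ B)
        rwa [map_ofNat] at this
      exact h2.mul_right_eq_zero.1 hroot
    · simpa [h0] using hroot
  have hmem : x 0 ∈ Algebra.adjoin ℂ {y 0} := by
    rcases h0 with h0 | h0
    · rw [h0]; exact Algebra.subset_adjoin (Set.mem_singleton _)
    · rw [h0]; exact Subalgebra.zero_mem _
  refine adjoin_le_span_staircase_succ y (Algebra.adjoin ℂ {y 0})
    (Algebra.subset_adjoin (Set.mem_singleton _)) ?_ ?_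
  · have hX : (aeval (y 0)) (X ^ (n + 1) : ℂ[X]) = 0 := by simpa using hnil
    rw [← Submodule.span_range_natDegree_eq_adjoin (monic_X_pow (n + 1)) hX, natDegree_X_pow]
    refine Submodule.span_mono ?_
    intro z hz
    simp only [Finset.coe_image, Finset.coe_range, Set.mem_image, Set.mem_Iio] at hz
    obtain ⟨k, hk, rfl⟩ := hz
    exact ⟨k, hk, rfl⟩
  · obtain ⟨Q, hQ⟩ := exists_map_eq_prod_tail (A := Algebra.adjoin ℂ {y 0}) y
      ⟨y 0, Algebra.subset_adjoin (Set.mem_singleton _)⟩ rfl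
      (X ^ (n + 1) + C (⟨x 0, hmem⟩ : Algebra.adjoin ℂ {y 0}) * X ^ n)
      (by rw [hprod]; simp [Subalgebra.algebraMap_eq])
    exact adjoin_le_span_staircase _ Q hQ

open MvPolynomial

/-- The staircase bound for the quotient by the leading forms and `X i`, lifted back to polynomials.
-/
lemma exists_sub_mem_leadingForm_sup (n : ℕ) (i : Fin (n + 2)) (p : MvPolynomial (Fin (n + 2)) ℂ) :
    ∃ u ∈ Submodule.span ℂ
      (staircase fun j => (X (i.succAbove j) : MvPolynomial (Fin (n + 2)) ℂ)),
      p - u ∈ Ideal.span (Set.range (leadingForm n)) ⊔ Ideal.span {X i} := by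
  set I := Ideal.span (Set.range (leadingForm n)) ⊔ Ideal.span {X i} with hI
  let π := Ideal.Quotient.mkₐ ℂ I
  have hπ : ∀ q, π q = 0 ↔ q ∈ I := fun q => Ideal.Quotient.eq_zero_iff_mem
  have haeval : ∀ q, aeval (fun j => π (X j)) q = π q := fun q =>
    DFunLike.congr_fun (MvPolynomial.algHom_ext (f := aeval fun j => π (X j)) (g := π)
      fun j => by simp) q
  have hi : π (X i) = 0 :=
    (hπ _).2 (Ideal.mem_sup_right (Ideal.subset_span (Set.mem_singleton _)))
  have h := adjoin_succAbove_le_span_staircase (fun j => π (X j)) (fun j => by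
    rw [haeval, hπ]
    exact Ideal.mem_sup_left (Ideal.subset_span ⟨j, rfl⟩)) hi
  have hp : π p ∈ Algebra.adjoin ℂ (Set.range fun j => π (X (i.succAbove j))) := by
    rw [← haeval]
    have hle : Algebra.adjoin ℂ (Set.range fun j => π (X j)) ≤
        Algebra.adjoin ℂ (Set.range fun j => π (X (i.succAbove j))) := by
      rw [Algebra.adjoin_le_iff]
      rintro _ ⟨j, rfl⟩
      rcases eq_or_ne j i with rfl | hj
      · simp only [hi]; exact Subalgebra.zero_mem _
      · obtain ⟨l, rfl⟩ := Fin.exists_succAbove_eq hj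
        exact Algebra.subset_adjoin ⟨l, rfl⟩
    apply hle
    rw [Algebra.adjoin_range_eq_range_aeval]
    exact ⟨p, rfl⟩
  have hst : staircase (fun j => π (X (i.succAbove j))) =
      π.toLinearMap '' staircase fun j => (X (i.succAbove j) : MvPolynomial (Fin (n + 2)) ℂ) := by
    ext z
    constructor
    · rintro ⟨a, ha, rfl⟩
      exact ⟨_, ⟨a, ha, rfl⟩, by simp⟩
    · rintro ⟨_, ⟨a, ha, rfl⟩, rfl⟩
      exact ⟨a, ha, by simp⟩
  have hp' := h hp
  rw [hst, Submodule.span_image] at hp'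
  obtain ⟨u, hu, hup⟩ := hp'
  refine ⟨u, hu, ?_⟩
  rw [← hπ, map_sub, sub_eq_zero]
  exact hup.symm

lemma span_leadingBasis_sup_eq_top (n : ℕ) :
    Submodule.span ℂ (leadingBasis n '' {a | ∀ i, a i < leadingDegrees n i}) ⊔
      (Ideal.span (Set.range (leadingForms n))).restrictScalars ℂ = ⊤ := by
  rw [eq_top_iff]
  intro p _
  obtain ⟨u, hu, hpu⟩ := exists_sub_mem_sup_span_prod (k := ℂ)
    (Ideal.span (Set.range (leadingForm n))) (fun i => X (Fin.ofNat (n + 2) i))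
    (fun i => staircase fun j => X ((Fin.ofNat (n + 2) i).succAbove j)) (n + 1)
    (fun i _ p => exists_sub_mem_leadingForm_sup n _ p) p
  rw [← add_sub_cancel u p]
  refine Submodule.add_mem_sup (Submodule.span_mono ?_ hu) ?_
  · rintro _ ⟨i, hi, _, ⟨a, ha, rfl⟩, rfl⟩
    refine ⟨Fin.cons i a, ?_, by simp [leadingBasis]⟩
    intro j
    cases j using Fin.cases with
    | zero => simpa [leadingDegrees] using hi
    | succ j => simpa [leadingDegrees] using ha j
  · rw [Submodule.restrictScalars_mem]
    refine (sup_le (Ideal.span_le.2 ?_) (Ideal.span_le.2 ?_) : _ ≤ Ideal.span _) hpu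
    · rintro _ ⟨j, rfl⟩
      exact Ideal.subset_span ⟨j.rev.succ, by simp [leadingForms]⟩
    · rw [Set.singleton_subset_iff]
      refine Ideal.subset_span ⟨0, ?_⟩
      rw [leadingForms, Fin.cons_zero, Finset.prod_range]
      refine Finset.prod_congr rfl fun i _ => ?_
      congr 1
      ext
      simp

end LeadingSpan

/-! ### The dimension and the count -/

open MvPolynomial

lemma prod_leadingDegrees (n : ℕ) : ∏ i, leadingDegrees n i = (n + 1) * (n + 1).factorial := by
  rw [Fin.prod_univ_succ]
  simp only [leadingDegrees, Fin.cons_zero, Fin.cons_succ]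
  congr 1
  rw [← Equiv.prod_comp Fin.revPerm, ← Finset.prod_range_add_one_eq_factorial, Finset.prod_range]
  refine Finset.prod_congr rfl fun i _ => ?_
  rw [Fin.revPerm_apply, Fin.val_rev]
  omega

lemma nonempty_basis_quotient_idealTilde (n : ℕ) :
    Nonempty (Module.Basis (∀ i, Fin (leadingDegrees n i)) ℂ
      (MvPolynomial (Fin (n + 2)) ℂ ⧸ idealTilde (n + 2))) := by
  have hd : ∀ i, 0 < leadingDegrees n i := fun i => by
    cases i using Fin.cases with
    | zero => simp [leadingDegrees]
    | succ j =>
      have := j.isLt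
      simp only [leadingDegrees, Fin.cons_succ]
      omega
  have h := nonempty_basis_quotient hd (isHomogeneous_leadingForms n)
    (totalDegree_system_rev_sub_lt n) (isHomogeneous_leadingBasis n)
    (span_leadingBasis_sup_eq_top n)
  -- The reversed order matches degrees with staircase bounds; it does not change the ideal.
  have hr : Set.range (fun i : Fin (n + 2) => system (n + 2) i.rev) =
      Set.range (system (n + 2)) := Fin.revPerm.surjective.range_comp (system (n + 2))
  rwa [hr] at h

end Ulam

theorem mainTheorem3 (N : ℕ) (hN : 0 < N) (hrad : (Ulam.idealTildeStar N).IsRadical) :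
    (MvPolynomial.zeroLocus ℂ (Ulam.idealTilde N)).encard =
      (((N - 1) * (N - 1)! : ℕ) : ℕ∞) := by
  have hI : (Ulam.idealTilde N).IsRadical := Ulam.isRadical_span_of_homogenization _ hrad
  obtain _ | _ | n := N
  · omega
  -- For `N = 1` the only equation is the nonzero constant `1 - (-1) = 2`, so there are no zeros,
  -- matching `0 * 0! = 0`.
  · have htop : Ulam.idealTilde 1 = ⊤ := by
      rw [Ideal.eq_top_iff_one]
      have h : Ulam.system 1 0 = MvPolynomial.C 2 := by
        simp [Ulam.system, Ulam.alphaTilde, MvPolynomial.esymm_zero]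
        rw [one_add_one_eq_two, map_ofNat]
      have h2 : MvPolynomial.C 2 ∈ Ulam.idealTilde 1 := h ▸ Ideal.subset_span ⟨0, rfl⟩
      have h3 := Ideal.mul_mem_left _ (MvPolynomial.C 2⁻¹) h2
      rwa [← MvPolynomial.C_mul, inv_mul_cancel₀ two_ne_zero, MvPolynomial.C_1] at h3
    rw [htop, MvPolynomial.zeroLocus_top]
    simp
  · obtain ⟨b⟩ := Ulam.nonempty_basis_quotient_idealTilde n
    have := Module.Finite.of_basis b
    rw [Ulam.encard_zeroLocus_eq_finrank hI, Module.finrank_eq_card_basis b]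
    simp [Ulam.prod_leadingDegrees]
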